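/- Let $G$ be a countable discrete group and let $\mathcal A=\bigoplus_{g\in G}\mathcal A_g$ be a $G$-graded unital complex $*$-algebra, i.e. $\mathcal A_g\mathcal A_h\subseteq\mathcal A_{gh}$ and $\mathcal A_g^*\subseteq\mathcal A_{g^{-1}}$. Assume that the unital $*$-subalgebra $\mathcal B:=\mathcal A_e$ is commutative and countably generated. Let $\widehat{\mathcal B}^+$ be the set of characters (nonzero $*$-homomorphisms) $\chi:\mathcal B\to\mathbb C$ with $\chi\ge 0$ on $\sum\mathcal A^2\cap\mathcal B$, where $\sum\mathcal A^2$ is the set of finite sums of elements $a^*a$, $a\in\mathcal A$. Endow $\widehat{\mathcal B}^+$ with the weakest topology making all functions $f_b(\chi)=\chi(b)$, $b\in\mathcal B$, continuous, and with its Borel structure. Assume that $\widehat{\mathcal B}^+$ is nonempty and locally compact, and that $\chi(c^*d)\chi(d^*c)=\chi(c^*c)\chi(d^*d)$ for all $\chi\in\widehat{\mathcal B}^+$, $g\in G$, $c,d\in\mathcal A_g$. For $\chi\in\widehat{\mathcal B}^+$ and $g\in G$, the character $\chi^g\in\widehat{\mathcal B}^+$ is defined if $\chi(a^*a)\ne 0$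 for some $a\in\mathcal A_g$, and then $\chi^g(b)=\chi(a^*ba)/\chi(a^*a)$ for $b\in\mathcal B$ (this does not depend on $a$). Put $\mathrm{Orb}\,\chi=\{\chi^g : g\in G,\ \chi^g\text{ is defined}\}$ and $\Delta^g=\{\chi^g:\chi\in\Delta,\ \chi^g\text{ is defined}\}$ for $\Delta\subseteq\widehat{\mathcal B}^+$. A spectral measure $E$ on $\widehat{\mathcal B}^+$ (a countably additive projection-valued Borel measure on a Hilbert space with $E(\widehat{\mathcal B}^+)=I$) is ergodic if for every Borel set $\Delta$ with $\Delta^g\subseteq\Delta$ for all $g\in G$, either $E(\Delta)=0$ or $E(\widehat{\mathcal B}^+\setminus\Delta)=0$. It is supported on a Borel set $S$ if $E(\widehat{\mathcal B}^+\setminus S)=0$. A $*$-representation $\pi$ of $\mathcal A$ on a dense subspace $\mathcal D(\pi)$ of a Hilbert space is irreducible if $\pi=\pi_1\oplus\pi_2$ is only possible with $\mathcal D(\pi_1)=\{0\}$ or $\mathcal D(\pi_2)=\{0\}$. The restriction of $\pi$ to $\mathcal B$ is integrable if $\mathcal D(\pi)$ is complete in the topology given by the norms $\|\varphi\|+\|\pi(b)\varphi\|$,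 $b\in\mathcal B$, and $\overline{\pi(b^*)}=\pi(b)^*$ for all $b\in\mathcal B$. A spectral measure $E$ on $\widehat{\mathcal B}^+$ is associated with $\pi$ if the restriction of $\pi$ to $\mathcal B$ is integrable and $\overline{\pi(b)}=\int f_b\,dE$ for all $b\in\mathcal B$. The representation $\pi$ is well-behaved if there is a spectral measure $E$ associated with $\pi$ such that $E(\Delta^g)\pi(a)\subseteq\pi(a)E(\Delta)$ for all $g\in G$, $a\in\mathcal A_g$ and Borel sets $\Delta\subseteq\widehat{\mathcal B}^+$. A well-behaved $\pi$ is associated with the orbit $\mathrm{Orb}\,\chi$ if every spectral measure associated with $\pi$ is supported on $\mathrm{Orb}\,\chi$. Suppose that there is a Borel set $\Gamma\subseteq\widehat{\mathcal B}^+$ that contains precisely one point of each orbit and is countably separated, i.e. there are countably many Borel subsets of $\Gamma$ such that for any two distinct points of $\Gamma$ one of these subsets contains exactly one of the two points. Then: (1) every ergodic spectral measure on $\widehat{\mathcal B}^+$ is supported on a single orbit $\mathrm{Orb}\,\chi$, $\chi\in\widehat{\mathcal B}^+$; (2) every irreducible well-behaved representation of $\mathcal A$ is associated with an orbit $\mathrm{Orb}\,\chi$,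 $\chi\in\widehat{\mathcal B}^+$. -/

import Mathlib

open MeasureTheory
open scoped ComplexOrder InnerProductSpace LinearPMap

universe u v w

noncomputable section

/-! ### Group graded `*`-algebras -/

/-- A `G`-grading of the unital complex `*`-algebra `A`: subspaces `comp g` such that
`A` is the (internal) direct sum of the `comp g`, `comp g * comp h ⊆ comp (g * h)` and
`(comp g)* ⊆ comp g⁻¹`. -/
structure StarGrading (G : Type u) (A : Type v) [Group G] [Ring A] [StarRing A]
    [Algebra ℂ A] [StarModule ℂ A] where
  comp : G → Submodule ℂ A
  indep : iSupIndep comp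
  iSup_eq_top : ⨆ g, comp g = ⊤
  mul_mem : ∀ {g h : G} {a b : A}, a ∈ comp g → b ∈ comp h → a * b ∈ comp (g * h)
  star_mem : ∀ {g : G} {a : A}, a ∈ comp g → star a ∈ comp g⁻¹

/-- The cone `∑ A²` of finite sums of squares `a* a`. -/
def sumSquares (A : Type v) [Ring A] [StarRing A] : AddSubmonoid A :=
  AddSubmonoid.closure (Set.range fun a : A => star a * a)

lemma sumSquares_conj {A : Type v} [Ring A] [StarRing A] (a : A) {s : A}
    (hs : s ∈ sumSquares A) : star a * s * a ∈ sumSquares A := by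
  unfold sumSquares at hs ⊢
  induction hs using AddSubmonoid.closure_induction with
  | mem x hx =>
    obtain ⟨c, rfl⟩ := hx
    refine AddSubmonoid.subset_closure ⟨c * a, ?_⟩
    simp [mul_assoc]
  | zero => simp
  | add x y _ _ hx hy =>
    rw [mul_add, add_mul]
    exact add_mem hx hy

namespace StarGrading

variable {G : Type u} {A : Type v} [Group G] [Ring A] [StarRing A]
  [Algebra ℂ A] [StarModule ℂ A] (𝒢 : StarGrading G A)

lemma one_mem : (1 : A) ∈ 𝒢.comp 1 := by
  have hsup : 𝒢.comp 1 ⊔ (⨆ g, ⨆ _ : g ≠ 1, 𝒢.comp g) = ⊤ := by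
    rw [eq_top_iff, ← 𝒢.iSup_eq_top]
    refine iSup_le fun g => ?_
    by_cases hg : g = 1
    · subst hg; exact le_sup_left
    · exact le_sup_of_le_right (le_iSup₂_of_le g hg le_rfl)
  obtain ⟨e, he, r, hr, her⟩ := Submodule.mem_sup.1 (hsup ▸ Submodule.mem_top : (1 : A) ∈ _)
  have key : ∀ (h : G), ∀ a ∈ 𝒢.comp h, r * a = 0 := by
    intro h a ha
    have h1 : r * a ∈ ⨆ k, ⨆ _ : k ≠ h, 𝒢.comp k := by
      have hle : (⨆ g, ⨆ _ : g ≠ 1, 𝒢.comp g) ≤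
          (⨆ k, ⨆ _ : k ≠ h, 𝒢.comp k).comap (LinearMap.mulRight ℂ a) := by
        refine iSup₂_le fun g hg x hx => ?_
        have hne : g * h ≠ h := fun hh => hg (by simpa using hh)
        exact (le_iSup₂_of_le (f := fun k (_ : k ≠ h) => 𝒢.comp k) (g * h) hne le_rfl)
          (𝒢.mul_mem hx ha)
      exact hle hr
    have h2 : r * a ∈ 𝒢.comp h := by
      have hra : r * a = a - e * a := by
        rw [eq_sub_iff_add_eq, add_comm, ← add_mul, her, one_mul]
      rw [hra]
      have := 𝒢.mul_mem he ha
      rw [one_mul] at this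
      exact sub_mem ha this
    exact (Submodule.disjoint_def.1 (𝒢.indep h)) _ h2 h1
  have hr0 : r = 0 := by
    have hle : (⊤ : Submodule ℂ A) ≤ LinearMap.ker (LinearMap.mulLeft ℂ r) := by
      rw [← 𝒢.iSup_eq_top]
      exact iSup_le fun g a ha => key g a ha
    have : r * 1 = 0 := hle (Submodule.mem_top (x := (1 : A)))
    simpa using this
  rw [← her, hr0, add_zero]
  exact he

/-- The unital `*`-subalgebra `B = A_e`. -/
def base : StarSubalgebra ℂ A where
  carrier := 𝒢.comp 1
  mul_mem' ha hb := by simpa using 𝒢.mul_mem ha hb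
  one_mem' := 𝒢.one_mem
  add_mem' ha hb := add_mem ha hb
  zero_mem' := zero_mem _
  algebraMap_mem' r := by
    change algebraMap ℂ A r ∈ 𝒢.comp 1
    rw [Algebra.algebraMap_eq_smul_one]
    exact Submodule.smul_mem _ _ 𝒢.one_mem
  star_mem' ha := by simpa using 𝒢.star_mem ha

/-- For `c, d ∈ A_g`, the element `c* d` of `B`. -/
def starMul {g : G} (c d : 𝒢.comp g) : 𝒢.base :=
  ⟨star (c : A) * d, by
    have := 𝒢.mul_mem (𝒢.star_mem c.2) d.2
    rwa [inv_mul_cancel] at this⟩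

/-- For `b ∈ B` and `a ∈ A_g`, the element `a* b a` of `B`. -/
def conj {g : G} (a : 𝒢.comp g) (b : 𝒢.base) : 𝒢.base :=
  ⟨star (a : A) * b * a, by
    have h1 : star (a : A) * b ∈ 𝒢.comp (g⁻¹ * 1) := 𝒢.mul_mem (𝒢.star_mem a.2) b.2
    have h2 := 𝒢.mul_mem h1 a.2
    rw [mul_one, inv_mul_cancel] at h2
    exact h2⟩

/-! ### The space of positive characters and the partial action -/

/-- `B̂⁺`: the characters of `B` (nonzero, equivalently unital, `*`-homomorphisms `B → ℂ`) that are
nonnegative on `∑ A² ∩ B`. -/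
def PosChar : Type v :=
  {χ : 𝒢.base →⋆ₐ[ℂ] ℂ // ∀ b : 𝒢.base, (b : A) ∈ sumSquares A → 0 ≤ χ b}

variable {𝒢}

/-- The value `χ(b) = f_b(χ)`. -/
def PosChar.val (χ : 𝒢.PosChar) : 𝒢.base →⋆ₐ[ℂ] ℂ := Subtype.val χ

lemma PosChar.nonneg (χ : 𝒢.PosChar) {b : 𝒢.base} (hb : (b : A) ∈ sumSquares A) :
    0 ≤ χ.val b := Subtype.property χ b hb

variable (𝒢)

/-- The weakest topology on `B̂⁺` making all functions `f_b : χ ↦ χ(b)` continuous. -/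
instance : TopologicalSpace 𝒢.PosChar :=
  ⨅ b : 𝒢.base, TopologicalSpace.induced (fun χ => χ.val b) inferInstance

/-- The Borel structure of `B̂⁺`. -/
instance : MeasurableSpace 𝒢.PosChar := borel _

instance : BorelSpace 𝒢.PosChar := ⟨rfl⟩

/-- The compatibility condition `χ(c* d) χ(d* c) = χ(c* c) χ(d* d)` for all
`χ ∈ B̂⁺`, `g ∈ G` and `c, d ∈ A_g`. -/
def Compatible : Prop :=
  ∀ (χ : 𝒢.PosChar) (g : G) (c d : 𝒢.comp g),
    χ.val (𝒢.starMul c d) * χ.val (𝒢.starMul d c) =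
      χ.val (𝒢.starMul c c) * χ.val (𝒢.starMul d d)

/-- `B` is countably generated as a unital `*`-algebra. -/
def BaseCountablyGenerated : Prop :=
  ∃ S : Set 𝒢.base, S.Countable ∧ StarAlgebra.adjoin ℂ S = ⊤

variable {𝒢}

section act

lemma val_starMul_self_nonneg (χ : 𝒢.PosChar) {g : G} (a : 𝒢.comp g) :
    0 ≤ χ.val (𝒢.starMul a a) :=
  χ.nonneg (AddSubmonoid.subset_closure ⟨(a : A), rfl⟩)

variable [IsMulCommutative 𝒢.base]

lemma base_comm (b c : 𝒢.base) : b * c = c * b := IsMulCommutative.is_comm.comm b c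

/-- `χ(a* b a) χ(d* d) = χ(a* a) χ(d* b d)` for `a, d ∈ A_g`. -/
lemma val_conj_mul (χ : 𝒢.PosChar) {g : G} (a d : 𝒢.comp g) (b : 𝒢.base) :
    χ.val (𝒢.conj a b) * χ.val (𝒢.starMul d d) =
      χ.val (𝒢.starMul a a) * χ.val (𝒢.conj d b) := by
  rw [← map_mul, ← map_mul]
  congr 1
  have hm : (a : A) * star (d : A) ∈ 𝒢.base := by
    have := 𝒢.mul_mem a.2 (𝒢.star_mem d.2)
    rwa [mul_inv_cancel] at this
  have hc : (b : A) * ((a : A) * star (d : A)) = ((a : A) * star (d : A)) * b :=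
    congrArg Subtype.val (base_comm b ⟨_, hm⟩)
  apply Subtype.ext
  change star (a : A) * b * a * (star (d : A) * d) = star (a : A) * a * (star (d : A) * b * d)
  calc star (a : A) * b * a * (star (d : A) * d)
      = star (a : A) * (b * (a * star (d : A))) * d := by simp only [mul_assoc]
    _ = star (a : A) * a * (star (d : A) * b * d) := by rw [hc]; simp only [mul_assoc]

/-- `χ(a* b c a) χ(a* a) = χ(a* b a) χ(a* c a)`. -/
lemma val_conj_mul_mul (χ : 𝒢.PosChar) {g : G} (a : 𝒢.comp g) (b c : 𝒢.base) :
    χ.val (𝒢.conj a (b * c)) * χ.val (𝒢.starMul a a) =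
      χ.val (𝒢.conj a b) * χ.val (𝒢.conj a c) := by
  rw [← map_mul, ← map_mul]
  congr 1
  have hm : (a : A) * star (a : A) ∈ 𝒢.base := by
    have := 𝒢.mul_mem a.2 (𝒢.star_mem a.2)
    rwa [mul_inv_cancel] at this
  have hc : (c : A) * ((a : A) * star (a : A)) = ((a : A) * star (a : A)) * c :=
    congrArg Subtype.val (base_comm c ⟨_, hm⟩)
  apply Subtype.ext
  change star (a : A) * (b * c) * a * (star (a : A) * a)
    = star (a : A) * b * a * (star (a : A) * c * a)
  calc star (a : A) * (b * c) * a * (star (a : A) * a)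
      = star (a : A) * b * (c * (a * star (a : A))) * a := by simp only [mul_assoc]
    _ = star (a : A) * b * a * (star (a : A) * c * a) := by rw [hc]; simp only [mul_assoc]

/-- The character `b ↦ χ(a* b a) / χ(a* a)` for `a ∈ A_g` with `χ(a* a) ≠ 0`. -/
def conjChar (χ : 𝒢.PosChar) {g : G} (a : 𝒢.comp g) (ha : χ.val (𝒢.starMul a a) ≠ 0) :
    𝒢.PosChar :=
  ⟨{ toFun := fun b => χ.val (𝒢.conj a b) / χ.val (𝒢.starMul a a)
     map_one' := by
      have : 𝒢.conj a 1 = 𝒢.starMul a a := Subtype.ext (by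
        change star (a : A) * 1 * a = star (a : A) * a
        rw [mul_one])
      rw [this, div_self ha]
     map_mul' := fun b c => by
      rw [div_mul_div_comm, ← val_conj_mul_mul, mul_div_mul_right _ _ ha]
     map_zero' := by
      have : 𝒢.conj a 0 = 0 := Subtype.ext (by
        change star (a : A) * 0 * a = 0
        simp)
      rw [this, map_zero, zero_div]
     map_add' := fun b c => by
      have : 𝒢.conj a (b + c) = 𝒢.conj a b + 𝒢.conj a c := Subtype.ext (by
        change star (a : A) * (b + c) * a = star (a : A) * b * a + star (a : A) * c * a
        rw [mul_add, add_mul])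
      rw [this, map_add, add_div]
     commutes' := fun r => by
      have : 𝒢.conj a (algebraMap ℂ 𝒢.base r) = r • 𝒢.starMul a a := Subtype.ext (by
        change star (a : A) * (algebraMap ℂ A r) * a = r • (star (a : A) * a)
        rw [Algebra.algebraMap_eq_smul_one, mul_smul_comm, smul_mul_assoc, mul_one])
      rw [this, map_smul, smul_eq_mul, mul_div_assoc, div_self ha, mul_one]
      rfl
     map_star' := fun b => by
      have h1 : 𝒢.conj a (star b) = star (𝒢.conj a b) := Subtype.ext (by
        change star (a : A) * star (b : A) * a = star (star (a : A) * b * a)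
        simp [mul_assoc])
      have h2 : star (𝒢.starMul a a) = 𝒢.starMul a a := Subtype.ext (by
        change star (star (a : A) * a) = star (a : A) * a
        simp)
      rw [star_div₀, ← map_star, ← map_star, h1, h2] },
    fun b hb => div_nonneg (χ.nonneg (sumSquares_conj (a : A) hb))
      (val_starMul_self_nonneg χ a)⟩

end act

/-- `𝓓_g`: the set of `χ ∈ B̂⁺` for which `χ^g` is defined. -/
def actDomain (g : G) : Set 𝒢.PosChar :=
  {χ | ∃ a : 𝒢.comp g, χ.val (𝒢.starMul a a) ≠ 0}

variable [IsMulCommutative 𝒢.base]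

/-- The partial action: `act g χ = χ^g` for `χ ∈ 𝓓_g`. -/
def act (g : G) (χ : 𝒢.PosChar) (hχ : χ ∈ actDomain g) : 𝒢.PosChar :=
  conjChar χ hχ.choose hχ.choose_spec

/-- The defining formula `χ^g(b) = χ(a* b a) / χ(a* a)`, valid for any `a ∈ A_g` with
`χ(a* a) ≠ 0`. -/
lemma act_apply (g : G) (χ : 𝒢.PosChar) (hχ : χ ∈ actDomain g) (a : 𝒢.comp g)
    (ha : χ.val (𝒢.starMul a a) ≠ 0) (b : 𝒢.base) :
    (act g χ hχ).val b = χ.val (𝒢.conj a b) / χ.val (𝒢.starMul a a) := by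
  change χ.val (𝒢.conj hχ.choose b) / χ.val (𝒢.starMul hχ.choose hχ.choose) = _
  rw [div_eq_div_iff hχ.choose_spec ha, val_conj_mul, mul_comm]

/-- `Δ^g = {χ^g | χ ∈ 𝓓_g ∩ Δ}`. -/
def actSet (g : G) (Δ : Set 𝒢.PosChar) : Set 𝒢.PosChar :=
  {ψ | ∃ (χ : 𝒢.PosChar) (hχ : χ ∈ actDomain g), χ ∈ Δ ∧ act g χ hχ = ψ}

/-- `Orb χ = {χ^g | χ^g is defined}`. -/
def orbit (χ : 𝒢.PosChar) : Set 𝒢.PosChar :=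
  {ψ | ∃ (g : G) (hχ : χ ∈ actDomain g), act g χ hχ = ψ}

/-- A section of the partial action: a set that contains precisely one point of each orbit. -/
def IsActSection (Γ : Set 𝒢.PosChar) : Prop :=
  ∀ χ : 𝒢.PosChar, ∃! ψ, ψ ∈ Γ ∧ ψ ∈ orbit χ

/-- A Borel set `Δ` is invariant if `Δ^g ⊆ Δ` for all `g`. -/
def IsInvariant (Δ : Set 𝒢.PosChar) : Prop :=
  MeasurableSet Δ ∧ ∀ g : G, actSet g Δ ⊆ Δ

end StarGrading

/-! ### Spectral measures and spectral integrals -/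

/-- A spectral measure (resolution of the identity) on the measurable space `X`, with values in
the orthogonal projections of the Hilbert space `H`. Only the values on measurable sets matter. -/
structure SpectralMeasure (X : Type v) [MeasurableSpace X] (H : Type w)
    [NormedAddCommGroup H] [InnerProductSpace ℂ H] [CompleteSpace H] where
  proj : Set X → H →L[ℂ] H
  isStarProjection : ∀ Δ, MeasurableSet Δ → IsStarProjection (proj Δ)
  proj_univ : proj Set.univ = 1
  proj_inter : ∀ Δ₁ Δ₂, MeasurableSet Δ₁ → MeasurableSet Δ₂ →
    proj (Δ₁ ∩ Δ₂) = proj Δ₁ * proj Δ₂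
  hasSum_iUnion : ∀ Δ : ℕ → Set X, (∀ n, MeasurableSet (Δ n)) →
    Pairwise (Function.onFun Disjoint Δ) → ∀ x : H,
      HasSum (fun n => proj (Δ n) x) (proj (⋃ n, Δ n) x)

namespace SpectralMeasure

variable {X : Type v} [MeasurableSpace X] {H : Type w}
  [NormedAddCommGroup H] [InnerProductSpace ℂ H] [CompleteSpace H] (E : SpectralMeasure X H)

lemma proj_empty_apply (x : H) : E.proj ∅ x = 0 := by
  have h := E.hasSum_iUnion (fun _ => ∅) (fun _ => MeasurableSet.empty)
    (fun _ _ _ => disjoint_bot_left) x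
  exact tendsto_nhds_unique tendsto_const_nhds h.summable.tendsto_atTop_zero

lemma re_inner_proj (x : H) {Δ : Set X} (hΔ : MeasurableSet Δ) :
    (⟪x, E.proj Δ x⟫_ℂ).re = ‖E.proj Δ x‖ ^ 2 := by
  have hp := E.isStarProjection Δ hΔ
  have h1 : E.proj Δ (E.proj Δ x) = E.proj Δ x :=
    congrArg (fun T : H →L[ℂ] H => T x) hp.isIdempotentElem
  have h2 : ContinuousLinearMap.adjoint (E.proj Δ) = E.proj Δ := hp.isSelfAdjoint
  calc (⟪x, E.proj Δ x⟫_ℂ).re = (⟪x, E.proj Δ (E.proj Δ x)⟫_ℂ).re := by rw [h1]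
    _ = (⟪E.proj Δ x, E.proj Δ x⟫_ℂ).re := by
      rw [← ContinuousLinearMap.adjoint_inner_left, h2]
    _ = ‖E.proj Δ x‖ ^ 2 := by
      rw [inner_self_eq_norm_sq_to_K]; norm_cast

/-- The finite positive measure `Δ ↦ ⟨E(Δ) x, x⟩`. -/
def vecMeasure (x : H) : Measure X :=
  Measure.ofMeasurable (fun Δ _ => ENNReal.ofReal (⟪x, E.proj Δ x⟫_ℂ).re)
    (by simp [proj_empty_apply])
    (by
      intro Δ hΔ hd
      have h := E.hasSum_iUnion Δ hΔ hd x
      have h' : HasSum (fun n => (⟪x, E.proj (Δ n) x⟫_ℂ).re)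
          (⟪x, E.proj (⋃ n, Δ n) x⟫_ℂ).re :=
        (h.mapL (Complex.reCLM.comp ((innerSL ℂ x).restrictScalars ℝ)))
      rw [← h'.tsum_eq]
      exact ENNReal.ofReal_tsum_of_nonneg
        (fun n => by rw [E.re_inner_proj x (hΔ n)]; positivity) h'.summable)

/-- `T = ∫ f dE`: the domain of `T` consists of all `x` with `∫ |f|² d⟨E x, x⟩ < ∞`, and
`⟨T x, x⟩ = ∫ f d⟨E x, x⟩` on the domain. (By polarization, the quadratic form on its dense domain
determines the operator.) -/
def IsSpectralIntegral (f : X → ℂ) (T : H →ₗ.[ℂ] H) : Prop :=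
  (∀ x : H, x ∈ T.domain ↔ MemLp f 2 (E.vecMeasure x)) ∧
    ∀ x : T.domain, ⟪(x : H), T x⟫_ℂ = ∫ t, f t ∂(E.vecMeasure (x : H))

/-- `E` is supported on the measurable set `S`. -/
def SupportedOn (S : Set X) : Prop :=
  MeasurableSet S ∧ E.proj Sᶜ = 0

end SpectralMeasure

/-- `E` is ergodic under the partial action: `E(Δ) = 0` or `E(B̂⁺ \ Δ) = 0` for every invariant
Borel set `Δ`. -/
def SpectralMeasure.IsErgodic {G : Type u} {A : Type v} [Group G] [Ring A] [StarRing A]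
    [Algebra ℂ A] [StarModule ℂ A] {𝒢 : StarGrading G A} [IsMulCommutative 𝒢.base]
    {H : Type w} [NormedAddCommGroup H] [InnerProductSpace ℂ H] [CompleteSpace H]
    (E : SpectralMeasure 𝒢.PosChar H) : Prop :=
  ∀ Δ : Set 𝒢.PosChar, StarGrading.IsInvariant Δ → E.proj Δ = 0 ∨ E.proj Δᶜ = 0

/-! ### Unbounded `*`-representations -/

/-- A `*`-representation of the `*`-algebra `A` on a dense domain of the Hilbert space `H`. It is
not required that the unit acts as the identity. -/
structure StarRep (A : Type v) [Ring A] [StarRing A] [Algebra ℂ A]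
    (H : Type w) [NormedAddCommGroup H] [InnerProductSpace ℂ H] [CompleteSpace H] where
  domain : Submodule ℂ H
  dense_domain : Dense (domain : Set H)
  toHom : A →ₙₐ[ℂ] Module.End ℂ domain
  inner_star : ∀ (a : A) (x y : domain),
    ⟪(toHom a x : H), (y : H)⟫_ℂ = ⟪(x : H), (toHom (star a) y : H)⟫_ℂ

namespace StarRep

section general

variable {A : Type v} [Ring A] [StarRing A] [Algebra ℂ A]
  {H : Type w} [NormedAddCommGroup H] [InnerProductSpace ℂ H] [CompleteSpace H]
  (π : StarRep A H)

/-- `π(a)` as a densely defined operator on `H`. -/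
def op (a : A) : H →ₗ.[ℂ] H :=
  ⟨π.domain, π.domain.subtype ∘ₗ π.toHom a⟩

/-- The uniform structure of the graph topology on `𝓓(π)`, given by the norms
`‖x‖ + ‖π(a) x‖`, `a ∈ A`. -/
@[reducible] def graphUniformSpace : UniformSpace π.domain :=
  UniformSpace.comap (fun x => ((x : H), fun a : A => (π.toHom a x : H))) inferInstance

/-- `π` is closed if `𝓓(π)` is complete in the graph topology. -/
def IsClosed : Prop := @CompleteSpace π.domain π.graphUniformSpace

/-- `π` is irreducible: whenever `π` is the direct sum of its restrictions to two orthogonal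
invariant subspaces of `𝓓(π)`, one of them is zero. -/
def IsIrreducible : Prop :=
  ∀ D₁ D₂ : Submodule ℂ π.domain,
    (∀ a, ∀ x ∈ D₁, π.toHom a x ∈ D₁) → (∀ a, ∀ x ∈ D₂, π.toHom a x ∈ D₂) →
    (∀ x ∈ D₁, ∀ y ∈ D₂, ⟪(x : H), (y : H)⟫_ℂ = 0) → D₁ ⊔ D₂ = ⊤ → D₁ = ⊥ ∨ D₂ = ⊥

/-- The restriction of `π` to a `*`-subalgebra. -/
def res [StarModule ℂ A] (B : StarSubalgebra ℂ A) : StarRep B H where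
  domain := π.domain
  dense_domain := π.dense_domain
  toHom := π.toHom.comp (B.subtype : B →ₙₐ[ℂ] A)
  inner_star b x y := π.inner_star (b : A) x y

/-- A `*`-representation (of a commutative `*`-algebra) is integrable if it is closed and
`closure (π(b*)) = π(b)*` for all `b`. -/
def IsIntegrable : Prop :=
  π.IsClosed ∧ ∀ b : A, (π.op (star b)).closure = (π.op b)†

end general

variable {G : Type u} {A : Type v} [Group G] [Ring A] [StarRing A]
  [Algebra ℂ A] [StarModule ℂ A] {𝒢 : StarGrading G A}
  {H : Type w} [NormedAddCommGroup H] [InnerProductSpace ℂ H] [CompleteSpace H]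

/-- `E` is a spectral measure on `B̂⁺` associated with `π`: the restriction of `π` to `B` is
integrable and `closure (π(b)) = ∫ f_b dE` for all `b ∈ B`. -/
def IsAssociated (π : StarRep A H) (E : SpectralMeasure 𝒢.PosChar H) : Prop :=
  (π.res 𝒢.base).IsIntegrable ∧
    ∀ b : 𝒢.base, E.IsSpectralIntegral (fun χ => χ.val b) (π.op (b : A)).closure

variable (𝒢) [IsMulCommutative 𝒢.base]

/-- `π` is well-behaved: there is an associated spectral measure `E` on `B̂⁺` such that
`E(Δ^g) π(a) ⊆ π(a) E(Δ)` (as unbounded operators) for all `g ∈ G`, `a ∈ A_g` and Borel sets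
`Δ ⊆ B̂⁺`. -/
def IsWellBehaved (π : StarRep A H) : Prop :=
  ∃ E : SpectralMeasure 𝒢.PosChar H, π.IsAssociated E ∧
    ∀ (g : G) (a : 𝒢.comp g) (Δ : Set 𝒢.PosChar), MeasurableSet Δ →
      ∀ x : π.domain, ∃ hx : E.proj Δ (x : H) ∈ π.domain,
        E.proj (StarGrading.actSet g Δ) (π.toHom (a : A) x : H) =
          (π.toHom (a : A) ⟨E.proj Δ (x : H), hx⟩ : H)

variable {𝒢}

/-- The well-behaved representation `π` is associated with the orbit `Orb χ`: its associated
spectral measure is supported on `Orb χ`. -/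
def IsAssociatedWithOrbit (π : StarRep A H) (χ : 𝒢.PosChar) : Prop :=
  π.IsWellBehaved 𝒢 ∧
    ∀ E : SpectralMeasure 𝒢.PosChar H, π.IsAssociated E → E.SupportedOn (StarGrading.orbit χ)

end StarRep

end

/-! A countably separated section makes the orbit space countably separated. Saturating countably
many Borel subsets of `Γ` gives countably many invariant Borel sets, and points lying in the same
ones share an orbit (`exists_countable_isInvariant_separating`). Ergodicity makes each of these sets
null or conull, so almost every point has the same membership pattern, which singles out one orbit.
This is (1), in `IsErgodic.exists_supportedOn_orbit`. For (2), covariance turns an invariant Borel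
set into an orthogonal splitting of the representation, so irreducibility forces ergodicity
(`IsIrreducible.isErgodic`), and (1) places the chosen spectral measure on an orbit. For the other
associated measures, full uniqueness is not needed: orbits are countable, masses of points are
determined by `π` (`IsAssociated.proj_singleton_eq`), and total mass is fixed, so the complement of
the orbit is null for all of them. -/

namespace StarGrading

variable {G : Type u} {A : Type v} [Group G] [Ring A] [StarRing A]
  [Algebra ℂ A] [StarModule ℂ A] {𝒢 : StarGrading G A}

/-! ### Topology of the space of positive characters -/

lemma PosChar.ext {χ ψ : 𝒢.PosChar} (h : ∀ b, χ.val b = ψ.val b) : χ = ψ :=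
  Subtype.ext (StarAlgHom.ext h)

lemma PosChar.continuous_val (b : 𝒢.base) : Continuous fun χ : 𝒢.PosChar => χ.val b :=
  continuous_iff_le_induced.2 (iInf_le _ b)

lemma PosChar.continuous_of_val {Y : Type*} [TopologicalSpace Y] {f : Y → 𝒢.PosChar}
    (h : ∀ b, Continuous fun y => (f y).val b) : Continuous f :=
  continuous_iInf_rng.2 fun b => continuous_induced_rng.2 (h b)

/-- Makes points, and hence countable orbits, Borel. -/
instance : T2Space 𝒢.PosChar :=
  T2Space.of_injective_continuous (f := fun (χ : 𝒢.PosChar) b => χ.val b)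
    (fun _ _ h => PosChar.ext (congrFun h)) (continuous_pi PosChar.continuous_val)

/-- Positive characters that agree on a generating set are equal. -/
lemma PosChar.ext_of_adjoin_eq_top {S : Set 𝒢.base} (hS : StarAlgebra.adjoin ℂ S = ⊤)
    {χ ψ : 𝒢.PosChar} (h : ∀ b ∈ S, χ.val b = ψ.val b) : χ = ψ :=
  Subtype.ext (StarAlgHom.ext_of_adjoin_eq_top hS h)

/-! ### The partial action -/

lemma mem_actDomain {g : G} {χ : 𝒢.PosChar} (a : 𝒢.comp g)
    (ha : χ.val (𝒢.starMul a a) ≠ 0) : χ ∈ actDomain g := ⟨a, ha⟩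

lemma isOpen_actDomain (g : G) : IsOpen (actDomain (𝒢 := 𝒢) g) := by
  have : actDomain (𝒢 := 𝒢) g = ⋃ a : 𝒢.comp g, {χ | χ.val (𝒢.starMul a a) ≠ 0} := by
    ext χ
    simp [actDomain]
  rw [this]
  exact isOpen_iUnion fun a => isOpen_ne_fun (PosChar.continuous_val _) continuous_const

variable [IsMulCommutative 𝒢.base]

lemma continuous_act (g : G) :
    Continuous fun χ : actDomain (𝒢 := 𝒢) g => act g χ.1 χ.2 := by
  refine PosChar.continuous_of_val fun b => continuous_iff_continuousAt.2 fun χ => ?_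
  -- One `a` serves a whole neighbourhood of `χ`, because the value of the action does not depend on
  -- the representative.
  obtain ⟨a, ha⟩ := χ.2
  have hc (c : 𝒢.base) : Continuous fun χ : actDomain (𝒢 := 𝒢) g => χ.1.val c :=
    (PosChar.continuous_val c).comp continuous_subtype_val
  refine ((hc (𝒢.conj a b)).continuousAt.div (hc (𝒢.starMul a a)).continuousAt ha).congr ?_
  filter_upwards [(isOpen_ne_fun (hc (𝒢.starMul a a)) continuous_const).mem_nhds ha] with ψ hψ
  exact (act_apply g ψ.1 ψ.2 a hψ b).symm

lemma act_one (χ : 𝒢.PosChar) : ∃ h : χ ∈ actDomain (1 : G), act 1 χ h = χ := by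
  have h1 : 𝒢.starMul ⟨1, 𝒢.one_mem⟩ ⟨1, 𝒢.one_mem⟩ = 1 := Subtype.ext (by
    change star (1 : A) * 1 = 1
    simp)
  have h2 (b : 𝒢.base) : 𝒢.conj ⟨1, 𝒢.one_mem⟩ b = b := Subtype.ext (by
    change star (1 : A) * b * 1 = b
    simp)
  have hne : χ.val (𝒢.starMul ⟨1, 𝒢.one_mem⟩ ⟨1, 𝒢.one_mem⟩) ≠ 0 := by simp [h1]
  refine ⟨mem_actDomain _ hne, PosChar.ext fun b => ?_⟩
  rw [act_apply _ _ _ _ hne, h1, h2]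
  simp

/-- If `a` represents `g` at `χ`, then `a*` represents `g⁻¹` at `χ^g`, since `a* (a b a*) a = (a* a)
b (a* a)`. -/
lemma act_inv_act (g : G) (χ : 𝒢.PosChar) (hχ : χ ∈ actDomain g) :
    ∃ h : act g χ hχ ∈ actDomain g⁻¹, act g⁻¹ (act g χ hχ) h = χ := by
  obtain ⟨a, ha⟩ := id hχ
  let d : 𝒢.comp g⁻¹ := ⟨star (a : A), 𝒢.star_mem a.2⟩
  have key (b : 𝒢.base) : (act g χ hχ).val (𝒢.conj d b) = χ.val (𝒢.starMul a a) * χ.val b := by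
    have : 𝒢.conj a (𝒢.conj d b) = 𝒢.starMul a a * b * 𝒢.starMul a a := Subtype.ext (by
      change star (a : A) * (star (star (a : A)) * b * star (a : A)) * a
        = star (a : A) * a * b * (star (a : A) * a)
      simp [mul_assoc])
    rw [act_apply g χ hχ a ha, this, map_mul, map_mul, mul_div_assoc, div_self ha, mul_one]
  have key1 : (act g χ hχ).val (𝒢.starMul d d) = χ.val (𝒢.starMul a a) := by
    have : 𝒢.starMul d d = 𝒢.conj d 1 := Subtype.ext (by
      change star (d : A) * d = star (d : A) * 1 * d
      rw [mul_one])
    rw [this, key, map_one, mul_one]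
  have hne : (act g χ hχ).val (𝒢.starMul d d) ≠ 0 := by rwa [key1]
  refine ⟨mem_actDomain d hne, PosChar.ext fun b => ?_⟩
  rw [act_apply _ _ _ d hne, key, key1, mul_div_cancel_left₀ _ ha]

/-- The product `c a` of representatives represents `h g`; the factors `χ(a* a)` cancel. -/
lemma act_act (g h : G) (χ : 𝒢.PosChar) (hχ : χ ∈ actDomain g)
    (hψ : act g χ hχ ∈ actDomain h) :
    ∃ hgh : χ ∈ actDomain (h * g), act (h * g) χ hgh = act h (act g χ hχ) hψ := by
  obtain ⟨a, ha⟩ := id hχ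
  obtain ⟨c, hc⟩ := id hψ
  let d : 𝒢.comp (h * g) := ⟨(c : A) * a, 𝒢.mul_mem c.2 a.2⟩
  have h1 : 𝒢.conj a (𝒢.starMul c c) = 𝒢.starMul d d := Subtype.ext (by
    change star (a : A) * (star (c : A) * c) * a = star ((c : A) * a) * (c * a)
    simp [mul_assoc])
  have h2 (b : 𝒢.base) : 𝒢.conj a (𝒢.conj c b) = 𝒢.conj d b := Subtype.ext (by
    change star (a : A) * (star (c : A) * b * c) * a = star ((c : A) * a) * b * (c * a)
    simp [mul_assoc])
  have hne : χ.val (𝒢.starMul d d) ≠ 0 := by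
    intro h0
    rw [act_apply g χ hχ a ha, h1, h0, zero_div] at hc
    exact hc rfl
  refine ⟨mem_actDomain d hne, PosChar.ext fun b => ?_⟩
  rw [act_apply _ _ _ d hne, act_apply _ _ hψ c hc, act_apply g χ hχ a ha,
    act_apply g χ hχ a ha, h1, h2, div_div_div_cancel_right₀ ha]

lemma mem_orbit_self (χ : 𝒢.PosChar) : χ ∈ orbit χ :=
  ⟨1, act_one χ⟩

lemma mem_orbit_symm {χ ψ : 𝒢.PosChar} (h : ψ ∈ orbit χ) : χ ∈ orbit ψ := by
  obtain ⟨g, hχ, rfl⟩ := h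
  exact ⟨g⁻¹, act_inv_act g χ hχ⟩

lemma mem_orbit_trans {χ ψ ω : 𝒢.PosChar} (h : ψ ∈ orbit χ) (h' : ω ∈ orbit ψ) :
    ω ∈ orbit χ := by
  obtain ⟨g, hχ, rfl⟩ := h
  obtain ⟨k, hψ, rfl⟩ := h'
  exact ⟨k * g, act_act g k χ hχ hψ⟩

lemma countable_orbit [Countable G] (χ : 𝒢.PosChar) : (orbit χ).Countable := by
  have : orbit χ = ⋃ g : G, {ψ | ∃ hχ : χ ∈ actDomain g, act g χ hχ = ψ} := by
    ext ψ
    simp [orbit]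
  rw [this]
  refine Set.countable_iUnion fun g => Set.Subsingleton.countable ?_
  rintro _ ⟨_, rfl⟩ _ ⟨_, rfl⟩
  rfl

lemma measurableSet_orbit [Countable G] (χ : 𝒢.PosChar) : MeasurableSet (orbit χ) :=
  (countable_orbit χ).measurableSet

/-! ### Borel translates, saturations and separation of orbits -/

/-- A translate is a preimage under the inverse partial map, which is continuous on an open set; so
its measurability needs no theorem on images of Borel sets. -/
lemma actSet_eq_image (g : G) (Δ : Set 𝒢.PosChar) :
    actSet g Δ =
      Subtype.val '' {ψ : actDomain (𝒢 := 𝒢) g⁻¹ | act g⁻¹ ψ.1 ψ.2 ∈ Δ} := by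
  ext ψ
  constructor
  · rintro ⟨χ, hχ, hΔ, rfl⟩
    obtain ⟨h, he⟩ := act_inv_act g χ hχ
    exact ⟨⟨_, h⟩, by simpa [he] using hΔ, rfl⟩
  · rintro ⟨⟨ψ, hψ⟩, hΔ, rfl⟩
    obtain ⟨h, he⟩ := act_inv_act g⁻¹ ψ hψ
    refine ⟨act g⁻¹ ψ hψ, by simpa using h, hΔ, ?_⟩
    simpa using he

lemma measurableSet_actSet (g : G) {Δ : Set 𝒢.PosChar} (hΔ : MeasurableSet Δ) :
    MeasurableSet (actSet g Δ) := by
  rw [actSet_eq_image]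
  exact (isOpen_actDomain g⁻¹).measurableSet.subtype_image
    ((continuous_act g⁻¹).measurable hΔ)

lemma IsInvariant.compl {Δ : Set 𝒢.PosChar} (h : IsInvariant Δ) : IsInvariant Δᶜ := by
  refine ⟨h.1.compl, ?_⟩
  rintro g _ ⟨χ, hχ, hΔ, rfl⟩ hmem
  obtain ⟨h', he⟩ := act_inv_act g χ hχ
  exact hΔ (h.2 g⁻¹ ⟨_, h', hmem, he⟩)

/-- The union of all orbits that meet `Δ`. -/
def saturation (Δ : Set 𝒢.PosChar) : Set 𝒢.PosChar := ⋃ g : G, actSet g Δ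

lemma mem_saturation {Δ : Set 𝒢.PosChar} {ψ : 𝒢.PosChar} :
    ψ ∈ saturation Δ ↔ ∃ χ ∈ Δ, ψ ∈ orbit χ := by
  simp only [saturation, Set.mem_iUnion, actSet, orbit, Set.mem_ofPred_eq]
  constructor
  · rintro ⟨g, χ, hχ, hΔ, h⟩
    exact ⟨χ, hΔ, g, hχ, h⟩
  · rintro ⟨χ, hΔ, g, hχ, h⟩
    exact ⟨g, χ, hχ, hΔ, h⟩

lemma isInvariant_saturation [Countable G] {Δ : Set 𝒢.PosChar} (hΔ : MeasurableSet Δ) :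
    IsInvariant (saturation Δ) := by
  refine ⟨MeasurableSet.iUnion fun g => measurableSet_actSet g hΔ, ?_⟩
  rintro g _ ⟨χ, hχ, hmem, rfl⟩
  obtain ⟨ψ, hψ, ho⟩ := mem_saturation.1 hmem
  exact mem_saturation.2 ⟨ψ, hψ, mem_orbit_trans ho ⟨g, hχ, rfl⟩⟩

/-- If a countably separated Borel section exists, then countably many invariant Borel sets
separate the orbits. -/
lemma exists_countable_isInvariant_separating [Countable G] {Γ : Set 𝒢.PosChar}
    (hΓ : IsActSection Γ) (hΓm : MeasurableSet Γ) (hΓs : MeasurableSpace.CountablySeparated Γ) :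
    ∃ S : Set (Set 𝒢.PosChar), S.Countable ∧ (∀ Δ ∈ S, IsInvariant Δ) ∧
      ∀ χ ψ : 𝒢.PosChar, (∀ Δ ∈ S, χ ∈ Δ ↔ ψ ∈ Δ) → ψ ∈ orbit χ := by
  obtain ⟨S, hSc, hSm, hS⟩ := hΓs.countably_separated.exists_countable_separating
  refine ⟨(fun s => saturation (Subtype.val '' s)) '' S, hSc.image _, ?_, fun χ ψ h => ?_⟩
  · rintro _ ⟨s, hs, rfl⟩
    exact isInvariant_saturation (hΓm.subtype_image (hSm s hs))
  -- Membership in a saturation only sees the section point of the orbit, so the separating family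
  -- of `Γ` is recovered.
  · have key : ∀ (ω : 𝒢.PosChar) (γ : Γ), γ.1 ∈ orbit ω → ∀ s : Set Γ,
        ω ∈ saturation (Subtype.val '' s) ↔ γ ∈ s := by
      intro ω γ hγ s
      rw [mem_saturation]
      constructor
      · rintro ⟨_, ⟨δ, hδ, rfl⟩, ho⟩
        have : γ = δ := Subtype.ext
          ((hΓ ω).unique ⟨γ.2, hγ⟩ ⟨δ.2, mem_orbit_symm ho⟩)
        rwa [this]
      · exact fun hs => ⟨γ, ⟨γ, hs, rfl⟩, mem_orbit_symm hγ⟩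
    obtain ⟨γ, ⟨hγΓ, hγ⟩, -⟩ := hΓ χ
    obtain ⟨δ, ⟨hδΓ, hδ⟩, -⟩ := hΓ ψ
    have heq : (⟨γ, hγΓ⟩ : Γ) = ⟨δ, hδΓ⟩ := by
      refine hS _ trivial _ trivial fun s hs => ?_
      rw [← key χ ⟨γ, hγΓ⟩ hγ s, ← key ψ ⟨δ, hδΓ⟩ hδ s]
      exact h _ ⟨s, hs, rfl⟩
    obtain rfl : γ = δ := congrArg Subtype.val heq
    exact mem_orbit_trans hγ (mem_orbit_symm hδ)

end StarGrading

/-! ### Spectral measures through their vector measures -/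

namespace SpectralMeasure

variable {X : Type v} [MeasurableSpace X] {H : Type w}
  [NormedAddCommGroup H] [InnerProductSpace ℂ H] [CompleteSpace H] (E F : SpectralMeasure X H)

lemma vecMeasure_apply (x : H) {Δ : Set X} (hΔ : MeasurableSet Δ) :
    E.vecMeasure x Δ = ENNReal.ofReal (‖E.proj Δ x‖ ^ 2) := by
  rw [vecMeasure, Measure.ofMeasurable_apply _ hΔ, E.re_inner_proj x hΔ]

lemma vecMeasure_univ (x : H) : E.vecMeasure x Set.univ = ENNReal.ofReal (‖x‖ ^ 2) := by
  rw [E.vecMeasure_apply x MeasurableSet.univ, E.proj_univ]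
  simp

instance (x : H) : IsFiniteMeasure (E.vecMeasure x) :=
  ⟨by rw [E.vecMeasure_univ]; exact ENNReal.ofReal_lt_top⟩

lemma vecMeasure_eq_zero (x : H) {Δ : Set X} (hΔ : MeasurableSet Δ) :
    E.vecMeasure x Δ = 0 ↔ E.proj Δ x = 0 := by
  rw [E.vecMeasure_apply x hΔ, ENNReal.ofReal_eq_zero]
  refine ⟨fun h => ?_, fun h => by simp [h]⟩
  simpa using le_antisymm h (by positivity)

lemma proj_eq_zero_iff {Δ : Set X} (hΔ : MeasurableSet Δ) :
    E.proj Δ = 0 ↔ ∀ x, E.vecMeasure x Δ = 0 := by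
  simp only [E.vecMeasure_eq_zero _ hΔ]
  exact ⟨fun h x => by simp [h], fun h => ContinuousLinearMap.ext h⟩

lemma proj_compl_mul {Δ : Set X} (hΔ : MeasurableSet Δ) (x : H) :
    E.proj Δ (E.proj Δᶜ x) = 0 := by
  have := congrArg (fun T : H →L[ℂ] H => T x) (E.proj_inter Δ Δᶜ hΔ hΔ.compl)
  rw [Set.inter_compl_self] at this
  exact this.symm.trans (E.proj_empty_apply x)

lemma norm_sq_add_norm_sq_compl {Δ : Set X} (hΔ : MeasurableSet Δ) (x : H) :
    ‖E.proj Δ x‖ ^ 2 + ‖E.proj Δᶜ x‖ ^ 2 = ‖x‖ ^ 2 := by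
  have h := measure_add_measure_compl (μ := E.vecMeasure x) hΔ
  rw [E.vecMeasure_apply x hΔ, E.vecMeasure_apply x hΔ.compl, E.vecMeasure_univ,
    ← ENNReal.ofReal_add (by positivity) (by positivity)] at h
  exact (ENNReal.ofReal_eq_ofReal_iff (by positivity) (by positivity)).1 h

/-- Both projections annihilate the difference of the two sides, so the Pythagorean identity makes
it zero. -/
lemma proj_add_proj_compl {Δ : Set X} (hΔ : MeasurableSet Δ) (x : H) :
    E.proj Δ x + E.proj Δᶜ x = x := by
  have h0 : E.proj Δ (x - E.proj Δ x) = 0 := by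
    have := congrArg (fun T : H →L[ℂ] H => T x) (E.isStarProjection Δ hΔ).isIdempotentElem
    simp only [mul_apply_eq_comp] at this
    rw [map_sub, this, sub_self]
  have h1 : E.proj Δᶜ (E.proj Δ x) = 0 := by
    simpa using E.proj_compl_mul hΔ.compl x
  have h2 := E.norm_sq_add_norm_sq_compl hΔ (x - E.proj Δ x)
  have h3 := E.norm_sq_add_norm_sq_compl hΔ.compl (x - E.proj Δ x - E.proj Δᶜ x)
  have h4 : E.proj Δᶜ (x - E.proj Δ x - E.proj Δᶜ x) = 0 := by
    have := congrArg (fun T : H →L[ℂ] H => T x)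
      (E.isStarProjection Δᶜ hΔ.compl).isIdempotentElem
    simp only [mul_apply_eq_comp] at this
    rw [map_sub, map_sub, this, h1]
    simp
  have h5 : E.proj Δ (x - E.proj Δ x - E.proj Δᶜ x) = 0 := by
    rw [map_sub, h0, E.proj_compl_mul hΔ, sub_zero]
  rw [compl_compl, h4, h5] at h3
  have h6 : x - E.proj Δ x - E.proj Δᶜ x = 0 := by
    simpa using h3.symm
  rw [sub_sub, sub_eq_zero] at h6
  exact h6.symm

/-- Two spectral measures agree on a set if the projections of its complement have the same
kernel. -/
lemma proj_eq_of_ker_compl_eq {Δ : Set X} (hΔ : MeasurableSet Δ)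
    (h : ∀ x, E.proj Δᶜ x = 0 ↔ F.proj Δᶜ x = 0) : E.proj Δ = F.proj Δ := by
  -- The kernel of the complementary projection is the range of `E(Δ)`, so both ranges coincide.
  have hrange : ∀ x, F.proj Δ (E.proj Δ x) = E.proj Δ x ∧ E.proj Δ (F.proj Δ x) = F.proj Δ x := by
    intro x
    constructor
    · have h0 : E.proj Δᶜ (E.proj Δ x) = 0 := by
        simpa using E.proj_compl_mul hΔ.compl x
      have := F.proj_add_proj_compl hΔ (E.proj Δ x)
      rwa [(h _).1 h0, add_zero] at this
    · have h0 : F.proj Δᶜ (F.proj Δ x) = 0 := by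
        simpa using F.proj_compl_mul hΔ.compl x
      have := E.proj_add_proj_compl hΔ (F.proj Δ x)
      rwa [(h _).2 h0, add_zero] at this
  have h1 : F.proj Δ * E.proj Δ = E.proj Δ := ContinuousLinearMap.ext fun x => (hrange x).1
  have h2 : E.proj Δ * F.proj Δ = F.proj Δ := ContinuousLinearMap.ext fun x => (hrange x).2
  -- Taking adjoints in `F(Δ) E(Δ) = E(Δ)` gives `E(Δ) F(Δ) = E(Δ)`, to compare with `h2`.
  have h3 := congrArg star h1
  rwa [star_mul, (E.isStarProjection Δ hΔ).isSelfAdjoint.star_eq,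
    (F.isStarProjection Δ hΔ).isSelfAdjoint.star_eq, h2, eq_comm] at h3

/-- Spectral measures that agree on the points of a countable set agree on the set. -/
lemma vecMeasure_eq_of_countable [MeasurableSingletonClass X] {S : Set X} (hS : S.Countable)
    (h : ∀ t ∈ S, E.proj {t} = F.proj {t}) (x : H) : E.vecMeasure x S = F.vecMeasure x S := by
  have hd : S.PairwiseDisjoint fun t : X => ({t} : Set X) := Set.pairwiseDisjoint_fiber id S
  rw [← Set.biUnion_of_singleton S,
    measure_biUnion hS hd fun t _ => measurableSet_singleton t,
    measure_biUnion hS hd fun t _ => measurableSet_singleton t]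
  refine tsum_congr fun t => ?_
  rw [E.vecMeasure_apply x (measurableSet_singleton _),
    F.vecMeasure_apply x (measurableSet_singleton _), h t.1 t.2]

/-- Both vector measures have total mass `‖x‖²` and equal mass on `S`, hence equal mass off `S`. -/
lemma SupportedOn.of_proj_singleton_eq [MeasurableSingletonClass X] {E F : SpectralMeasure X H}
    {S : Set X} (hS : S.Countable) (h : ∀ t ∈ S, E.proj {t} = F.proj {t})
    (hE : E.SupportedOn S) : F.SupportedOn S := by
  refine ⟨hE.1, (F.proj_eq_zero_iff hE.1.compl).2 fun x => ?_⟩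
  rw [measure_compl hE.1 (measure_ne_top _ _), ← E.vecMeasure_eq_of_countable F hS h,
    F.vecMeasure_univ, ← E.vecMeasure_univ, ← measure_compl hE.1 (measure_ne_top _ _)]
  exact (E.proj_eq_zero_iff hE.1.compl).1 hE.2 x

end SpectralMeasure

/-! ### Ergodic spectral measures -/

namespace SpectralMeasure

variable {G : Type u} {A : Type v} [Group G] [Ring A] [StarRing A]
  [Algebra ℂ A] [StarModule ℂ A] {𝒢 : StarGrading G A} [IsMulCommutative 𝒢.base]
  {H : Type w} [NormedAddCommGroup H] [InnerProductSpace ℂ H] [CompleteSpace H]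

/-- An ergodic spectral measure is supported on an orbit, provided that there is a countably
separated Borel section. -/
theorem IsErgodic.exists_supportedOn_orbit [Countable G] [Nonempty 𝒢.PosChar]
    {E : SpectralMeasure 𝒢.PosChar H} (hE : E.IsErgodic) {Γ : Set 𝒢.PosChar}
    (hΓ : StarGrading.IsActSection Γ) (hΓm : MeasurableSet Γ)
    (hΓs : MeasurableSpace.CountablySeparated Γ) :
    ∃ χ : 𝒢.PosChar, E.SupportedOn (StarGrading.orbit χ) := by
  obtain ⟨S, hSc, hSi, hS⟩ :=
    StarGrading.exists_countable_isInvariant_separating hΓ hΓm hΓs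
  -- The membership pattern that ergodicity prescribes almost everywhere; countability of `S` allows
  -- all its sets to be treated at once.
  let K : Set 𝒢.PosChar := {χ | ∀ Δ ∈ S, χ ∈ Δ ↔ E.proj Δ ≠ 0}
  have hK : ∀ x, ∀ᵐ χ ∂E.vecMeasure x, χ ∈ K := by
    intro x
    refine (ae_ball_iff hSc).2 fun Δ hΔ => ?_
    have hm := (hSi Δ hΔ).1
    by_cases h0 : E.proj Δ = 0
    · have : ∀ᵐ χ ∂E.vecMeasure x, χ ∉ Δ :=
        measure_eq_zero_iff_ae_notMem.1 ((E.proj_eq_zero_iff hm).1 h0 x)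
      filter_upwards [this] with χ hχ
      simp [hχ, h0]
    · have : ∀ᵐ χ ∂E.vecMeasure x, χ ∉ Δᶜ :=
        measure_eq_zero_iff_ae_notMem.1 ((E.proj_eq_zero_iff hm.compl).1
          ((hE Δ (hSi Δ hΔ)).resolve_left h0) x)
      filter_upwards [this] with χ hχ
      simpa [h0] using hχ
  obtain ⟨χ₀, hχ₀⟩ : ∃ χ₀ : 𝒢.PosChar, ∀ χ ∈ K, χ ∈ StarGrading.orbit χ₀ := by
    by_cases hne : K.Nonempty
    · obtain ⟨χ₀, h₀⟩ := hne
      exact ⟨χ₀, fun χ hχ => hS _ _ fun Δ hΔ => (h₀ Δ hΔ).trans (hχ Δ hΔ).symm⟩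
    -- `K` is empty only when `H = 0`; then any orbit will do.
    · exact ⟨Classical.arbitrary _, fun χ hχ => (hne ⟨χ, hχ⟩).elim⟩
  have hm := StarGrading.measurableSet_orbit χ₀
  refine ⟨χ₀, hm, (E.proj_eq_zero_iff hm.compl).2 fun x => ?_⟩
  exact measure_mono_null (fun χ hχ hχK => hχ (hχ₀ χ hχK)) (hK x)

end SpectralMeasure

namespace StarRep

variable {G : Type u} {A : Type v} [Group G] [Ring A] [StarRing A]
  [Algebra ℂ A] [StarModule ℂ A] {𝒢 : StarGrading G A}
  {H : Type w} [NormedAddCommGroup H] [InnerProductSpace ℂ H] [CompleteSpace H]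
  {π : StarRep A H} {E F : SpectralMeasure 𝒢.PosChar H}

/-! ### Uniqueness of the associated spectral measure on points -/

/-- `E({f_b ≠ 0}) x = 0` if and only if `x` is in the domain of the closure `T` of `π(b* b)` and
`⟨T x, x⟩ = 0`. -/
lemma IsAssociated.vecMeasure_ne_zero_iff (h : π.IsAssociated E) (b : 𝒢.base) (x : H) :
    E.vecMeasure x {χ | χ.val b ≠ 0} = 0 ↔
      ∃ hx : x ∈ (π.op ((star b * b : 𝒢.base) : A)).closure.domain,
        ⟪x, (π.op ((star b * b : 𝒢.base) : A)).closure ⟨x, hx⟩⟫_ℂ = 0 := by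
  obtain ⟨hdom, hint⟩ := h.2 (star b * b)
  -- A nonnegative integrand: its integral vanishes exactly when `f_b = 0` almost everywhere.
  have hval (χ : 𝒢.PosChar) : χ.val (star b * b) = ((‖χ.val b‖ ^ 2 : ℝ) : ℂ) := by
    rw [map_mul, map_star, Complex.star_def, Complex.conj_mul']
    norm_cast
  constructor
  · intro h0
    have hae : (fun χ : 𝒢.PosChar => χ.val (star b * b)) =ᵐ[E.vecMeasure x] 0 := by
      filter_upwards [measure_eq_zero_iff_ae_notMem.1 h0] with χ hχ
      have hχ' : χ.val b = 0 := not_not.1 hχ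
      simp [hχ']
    have hx := (hdom x).2 ((memLp_congr_ae hae).2 MemLp.zero)
    refine ⟨hx, ?_⟩
    rw [hint ⟨x, hx⟩, integral_congr_ae hae]
    simp
  · rintro ⟨hx, h0⟩
    have hL := (hdom x).1 hx
    rw [hint ⟨x, hx⟩] at h0
    simp only [hval] at h0 hL
    rw [integral_complex_ofReal, Complex.ofReal_eq_zero,
      integral_eq_zero_iff_of_nonneg (fun _ => by positivity)] at h0
    · refine measure_eq_zero_iff_ae_notMem.2 ?_
      filter_upwards [h0] with χ hχ
      simpa using hχ
    · exact (hL.integrable (by norm_num)).re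

/-- Off the point `χ`, some generator `b` has `f_b ≠ χ(b)`. This writes the complement as a
countable union of sets whose projections have kernels expressible through `π` alone. -/
lemma IsAssociated.proj_singleton_eq (hgen : 𝒢.BaseCountablyGenerated) (hE : π.IsAssociated E)
    (hF : π.IsAssociated F) (χ : 𝒢.PosChar) : E.proj {χ} = F.proj {χ} := by
  obtain ⟨S, hSc, hS⟩ := hgen
  have hcompl : ({χ} : Set 𝒢.PosChar)ᶜ =
      ⋃ b ∈ S, {ψ | ψ.val (b - algebraMap ℂ 𝒢.base (χ.val b)) ≠ 0} := by
    ext ψ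
    simp only [Set.mem_compl_iff, Set.mem_singleton_iff, Set.mem_iUnion, Set.mem_ofPred_eq,
      map_sub, AlgHomClass.commutes, Algebra.algebraMap_self, RingHom.id_apply, ne_eq,
      sub_eq_zero]
    constructor
    · intro hne
      by_contra! hall
      exact hne (StarGrading.PosChar.ext_of_adjoin_eq_top hS hall)
    · rintro ⟨b, _, hb⟩ rfl
      exact hb rfl
  have hm : MeasurableSet ({χ} : Set 𝒢.PosChar) := measurableSet_singleton χ
  refine E.proj_eq_of_ker_compl_eq F hm fun x => ?_
  rw [← E.vecMeasure_eq_zero x hm.compl, ← F.vecMeasure_eq_zero x hm.compl, hcompl,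
    measure_biUnion_null_iff hSc, measure_biUnion_null_iff hSc]
  simp only [hE.vecMeasure_ne_zero_iff, hF.vecMeasure_ne_zero_iff]

/-! ### Irreducible well-behaved representations -/

variable [IsMulCommutative 𝒢.base]

/-- The vectors of `𝓓(π)` that are fixed by `E(Δ)` for an invariant set `Δ` form an invariant
subspace. -/
lemma proj_toHom_eq_of_isInvariant
    (hcov : ∀ (g : G) (a : 𝒢.comp g) (Δ : Set 𝒢.PosChar), MeasurableSet Δ →
      ∀ x : π.domain, ∃ hx : E.proj Δ (x : H) ∈ π.domain,
        E.proj (StarGrading.actSet g Δ) (π.toHom (a : A) x : H) =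
          (π.toHom (a : A) ⟨E.proj Δ (x : H), hx⟩ : H))
    {Δ : Set 𝒢.PosChar} (hΔ : StarGrading.IsInvariant Δ) (a : A) {x : π.domain}
    (hx : E.proj Δ (x : H) = x) : E.proj Δ (π.toHom a x : H) = π.toHom a x := by
  have ha : a ∈ ⨆ g, 𝒢.comp g := 𝒢.iSup_eq_top ▸ Submodule.mem_top
  induction ha using Submodule.iSup_induction' with
  | mem g a ha =>
    obtain ⟨hx', he⟩ := hcov g ⟨a, ha⟩ Δ hΔ.1 x
    have hxx : (⟨E.proj Δ (x : H), hx'⟩ : π.domain) = x := Subtype.ext hx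
    rw [hxx] at he
    -- By `he`, `π(a) x` lies in the range of `E(Δ^g)`, which sits inside that of `E(Δ)` because
    -- `Δ^g ⊆ Δ`.
    have hi := E.proj_inter Δ (StarGrading.actSet g Δ) hΔ.1
      (StarGrading.measurableSet_actSet g hΔ.1)
    rw [Set.inter_eq_self_of_subset_right (hΔ.2 g)] at hi
    have hi' := congrArg (fun T : H →L[ℂ] H => T (π.toHom a x : H)) hi
    simp only [mul_apply_eq_comp] at hi'
    rw [he] at hi'
    exact hi'.symm
  | zero => simp
  | add a b _ _ iha ihb =>
    rw [map_add, LinearMap.add_apply, Submodule.coe_add, map_add, iha, ihb]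

/-- An invariant set and its complement, again invariant, split the domain into orthogonal invariant
pieces; a piece that is zero has zero projection by density. -/
lemma IsIrreducible.isErgodic (hπ : π.IsIrreducible)
    (hcov : ∀ (g : G) (a : 𝒢.comp g) (Δ : Set 𝒢.PosChar), MeasurableSet Δ →
      ∀ x : π.domain, ∃ hx : E.proj Δ (x : H) ∈ π.domain,
        E.proj (StarGrading.actSet g Δ) (π.toHom (a : A) x : H) =
          (π.toHom (a : A) ⟨E.proj Δ (x : H), hx⟩ : H)) : E.IsErgodic := by
  intro Δ hΔ
  -- Covariance for `g = 1`, `a = 0` is used only for its domain clause.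
  have hmem (Δ : Set 𝒢.PosChar) (hΔ : MeasurableSet Δ) (x : π.domain) :
      E.proj Δ (x : H) ∈ π.domain := (hcov 1 0 Δ hΔ x).1
  let D (Δ : Set 𝒢.PosChar) : Submodule ℂ π.domain :=
    LinearMap.ker (((E.proj Δ : H →ₗ[ℂ] H) - LinearMap.id) ∘ₗ π.domain.subtype)
  have hD (Δ : Set 𝒢.PosChar) (x : π.domain) : x ∈ D Δ ↔ E.proj Δ (x : H) = x := by
    simp [D, sub_eq_zero]
  have hinD (Δ : Set 𝒢.PosChar) (hΔ : MeasurableSet Δ) (x : π.domain) :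
      (⟨E.proj Δ (x : H), hmem Δ hΔ x⟩ : π.domain) ∈ D Δ := by
    rw [hD]
    exact congrArg (fun T : H →L[ℂ] H => T x) (E.isStarProjection Δ hΔ).isIdempotentElem
  have hbot (Δ : Set 𝒢.PosChar) (hΔ : MeasurableSet Δ) (h : D Δ = ⊥) : E.proj Δ = 0 := by
    refine ContinuousLinearMap.coeFn_injective ((E.proj Δ).continuous.ext_on π.dense_domain
      continuous_zero fun x hx => ?_)
    have := hinD Δ hΔ ⟨x, hx⟩
    rw [h, Submodule.mem_bot] at this
    exact congrArg Subtype.val this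
  have hinv (Δ : Set 𝒢.PosChar) (hΔ : StarGrading.IsInvariant Δ) :
      ∀ a, ∀ x ∈ D Δ, π.toHom a x ∈ D Δ := fun a x hx =>
    (hD Δ _).2 (proj_toHom_eq_of_isInvariant hcov hΔ a ((hD Δ x).1 hx))
  refine (hπ (D Δ) (D Δᶜ) (hinv Δ hΔ) (hinv Δᶜ hΔ.compl) ?_ ?_).imp (hbot Δ hΔ.1)
    (hbot Δᶜ hΔ.1.compl)
  · intro x hx y hy
    have hsa : ContinuousLinearMap.adjoint (E.proj Δ) = E.proj Δ :=
      (E.isStarProjection Δ hΔ.1).isSelfAdjoint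
    rw [← (hD Δ x).1 hx, ← (hD Δᶜ y).1 hy, ← hsa, ContinuousLinearMap.adjoint_inner_left,
      E.proj_compl_mul hΔ.1, inner_zero_right]
  · refine eq_top_iff.2 fun x _ => Submodule.mem_sup.2
      ⟨_, hinD Δ hΔ.1 x, _, hinD Δᶜ hΔ.1.compl x, Subtype.ext ?_⟩
    exact E.proj_add_proj_compl hΔ.1 (x : H)

end StarRep

theorem mainTheorem10 {G : Type u} {A : Type v} [Group G] [Countable G]
    [Ring A] [StarRing A] [Algebra ℂ A] [StarModule ℂ A]
    (𝒢 : StarGrading G A) [IsMulCommutative 𝒢.base]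
    (hcompat : 𝒢.Compatible) (hgen : 𝒢.BaseCountablyGenerated)
    [LocallyCompactSpace 𝒢.PosChar] [Nonempty 𝒢.PosChar]
    (Γ : Set 𝒢.PosChar) (hΓ : StarGrading.IsActSection Γ) (hΓm : MeasurableSet Γ)
    (hΓs : MeasurableSpace.CountablySeparated Γ) :
    (∀ (H : Type w) [NormedAddCommGroup H] [InnerProductSpace ℂ H] [CompleteSpace H]
        (E : SpectralMeasure 𝒢.PosChar H), E.IsErgodic →
        ∃ χ : 𝒢.PosChar, E.SupportedOn (StarGrading.orbit χ)) ∧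
    (∀ (H : Type w) [NormedAddCommGroup H] [InnerProductSpace ℂ H] [CompleteSpace H]
        (π : StarRep A H), π.IsIrreducible → π.IsWellBehaved 𝒢 →
        ∃ χ : 𝒢.PosChar, π.IsAssociatedWithOrbit χ) := by
  refine ⟨fun H _ _ _ E hE => hE.exists_supportedOn_orbit hΓ hΓm hΓs,
    fun H _ _ _ π hirr hwb => ?_⟩
  obtain ⟨E, hE, hcov⟩ := id hwb
  obtain ⟨χ, hχ⟩ := (hirr.isErgodic hcov).exists_supportedOn_orbit hΓ hΓm hΓs
  exact ⟨χ, hwb, fun F hF => hχ.of_proj_singleton_eq (StarGrading.countable_orbit χ)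
    fun ψ _ => hE.proj_singleton_eq hgen hF ψ⟩
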